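/- Let $d\in\mathbb N$ and work in $\mathbb R^d$ with the Euclidean norm; $B(x,\delta)$ is the open ball and $N_\delta(F)$ is the least number of balls of radius $\delta$ needed to cover a bounded set $F$. For $F\subset\mathbb R^d$ and $\theta\in(0,1)$, the Assouad spectrum is $$\dim_A^\theta F=\inf\Bigl\{a\in\mathbb R:(\exists M>0)(\forall\, 0<\delta\le 1)(\forall x\in F)\ N_{\delta^{1/\theta}}(F\cap B(x,\delta))\le M\Bigl(\frac{\delta}{\delta^{1/\theta}}\Bigr)^a\Bigr\},$$ and the Assouad dimension is $$\dim_A F=\inf\Bigl\{a\in\mathbb R:(\exists M>0)(\forall\, 0<\delta'<\delta)(\forall x\in F)\ N_{\delta'}(F\cap B(x,\delta))\le M\Bigl(\frac{\delta}{\delta'}\Bigr)^a\Bigr\}.$$ Let $\mathcal A_d$ be the set of functions $\varphi\colon(0,1)\to[0,d]$ such that for all $0<\lambda<\theta<1$ $$0\le(1-\lambda)\varphi(\lambda)-(1-\theta)\varphi(\theta)\le(\theta-\lambda)\,\varphi\Bigl(\frac{\lambda}{\theta}\Bigr).$$ A homogeneous Moran set in $\mathbb R^d$ is a set of the form $$C=\bigcap_{n=1}^\infty\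 \bigcup_{(\boldsymbol i_1,\dots,\boldsymbol i_n)\in(\{0,1\}^d)^n}S^1_{\boldsymbol i_1}\circ\cdots\circ S^n_{\boldsymbol i_n}([0,1]^d),$$ where $(r_n)_{n\ge1}\subset(0,1/2]$ and $S^n_{\boldsymbol i}(x)=r_nx+(1-r_n)\boldsymbol i$ for $\boldsymbol i\in\{0,1\}^d\subset\mathbb R^d$. Theorem. Let $\varphi\in\mathcal A_d$. Then the limit $\varphi(1):=\lim_{\theta\to1^-}\varphi(\theta)$ exists, and for every $\alpha\in\mathbb R$ with $\varphi(1)\le\alpha\le d$ there is a homogeneous Moran set $C\subset\mathbb R^d$ such that $\dim_A C=\alpha$ and $\dim_A^\theta C=\varphi(\theta)$ for all $\theta\in(0,1)$. -/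

import Mathlib

open Set Filter Topology

noncomputable section

namespace AssouadSpectra

/-- `ℝ^d` with the Euclidean norm. -/
abbrev E (d : ℕ) : Type := EuclideanSpace ℝ (Fin d)

/-- The class `𝒜_d` of functions `φ : (0,1) → [0,d]` such that
`0 ≤ (1-s)φ(s) - (1-t)φ(t) ≤ (t-s)φ(s/t)` for all `0 < s < t < 1`.
Functions on `(0,1)` are represented by functions on `ℝ` whose values off `(0,1)` are ignored. -/
def classA (d : ℕ) : Set (ℝ → ℝ) :=
  {φ | (∀ t ∈ Ioo (0 : ℝ) 1, φ t ∈ Icc (0 : ℝ) d) ∧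
    ∀ s t : ℝ, 0 < s → s < t → t < 1 →
      0 ≤ (1 - s) * φ s - (1 - t) * φ t ∧
      (1 - s) * φ s - (1 - t) * φ t ≤ (t - s) * φ (s / t)}

/-- `N_δ(F)`: the least number of open balls of radius `δ` that cover `F`
(for bounded `F` and `δ > 0` a finite cover exists, see `exists_cover`). -/
def coverNum {d : ℕ} (δ : ℝ) (F : Set (E d)) : ℕ :=
  sInf {n | ∃ t : Finset (E d), t.card = n ∧ F ⊆ ⋃ x ∈ t, Metric.ball x δ}

theorem exists_cover {d : ℕ} {δ : ℝ} (hδ : 0 < δ) {F : Set (E d)}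
    (hF : Bornology.IsBounded F) :
    ∃ t : Finset (E d), t.card = coverNum δ F ∧ F ⊆ ⋃ x ∈ t, Metric.ball x δ := by
  have hne : {n | ∃ t : Finset (E d), t.card = n ∧
      F ⊆ ⋃ x ∈ t, Metric.ball x δ}.Nonempty := by
    obtain ⟨t, ht, hsub⟩ := Metric.totallyBounded_iff.1
      (hF.isCompact_closure.totallyBounded.subset subset_closure) δ hδ
    exact ⟨_, ht.toFinset, rfl, by simpa using hsub⟩
  exact Nat.sInf_mem hne

/-- The Assouad spectrum of `F` at `θ`; the infimum of the admissible real exponents is taken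
in the extended reals. -/
def assouadSpectrum {d : ℕ} (θ : ℝ) (F : Set (E d)) : EReal :=
  ⨅ a ∈ {a : ℝ | ∃ C : ℝ, 0 < C ∧ ∀ δ : ℝ, 0 < δ → δ ≤ 1 → ∀ x ∈ F,
    (coverNum (δ ^ (1 / θ)) (F ∩ Metric.ball x δ) : ℝ) ≤ C * (δ / δ ^ (1 / θ)) ^ a}, (a : EReal)

/-- The Assouad dimension of `F`; the infimum of the admissible real exponents is taken
in the extended reals. -/
def assouadDim {d : ℕ} (F : Set (E d)) : EReal :=
  ⨅ a ∈ {a : ℝ | ∃ C : ℝ, 0 < C ∧ ∀ δ' δ : ℝ, 0 < δ' → δ' < δ → ∀ x ∈ F,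
    (coverNum δ' (F ∩ Metric.ball x δ) : ℝ) ≤ C * (δ / δ') ^ a}, (a : EReal)

/-- The similarity `x ↦ ρ x + b` where `b` has `j`-th coordinate `1 - ρ` if `i j` is `true`
and `0` otherwise. -/
def moranMap {d : ℕ} (ρ : ℝ) (i : Fin d → Bool) (x : E d) : E d :=
  ρ • x + WithLp.toLp 2 (fun j => if i j then 1 - ρ else 0)

/-- The composition `S_σ = S^1_{σ_1} ∘ ⋯ ∘ S^n_{σ_n}` for a word `σ` of length `n`,
where the ratio of the maps of level `n + 1` is `r n`. -/
def wordMap {d : ℕ} (r : ℕ → ℝ) : (n : ℕ) → (Fin n → (Fin d → Bool)) → E d → E d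
  | 0, _ => id
  | n + 1, σ => wordMap r n (Fin.init σ) ∘ moranMap (r n) (σ (Fin.last n))

/-- The cube `[0,1]^d`. -/
def unitCube (d : ℕ) : Set (E d) := {x | ∀ j, x j ∈ Icc (0 : ℝ) 1}

/-- The set `C(r) = ⋂_{n ≥ 1} ⋃_{σ of length n} S_σ([0,1]^d)`. -/
def moranSet (d : ℕ) (r : ℕ → ℝ) : Set (E d) :=
  ⋂ n : ℕ, ⋃ σ : Fin (n + 1) → (Fin d → Bool), wordMap r (n + 1) σ '' unitCube d

/-- Homogeneous Moran sets in `ℝ^d`: the sets `C(r)` with all ratios in `(0,1/2]`. -/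
def IsHomogeneousMoranSet {d : ℕ} (C : Set (E d)) : Prop :=
  ∃ r : ℕ → ℝ, (∀ n, r n ∈ Ioc (0 : ℝ) (1 / 2)) ∧ C = moranSet d r

end AssouadSpectra

end

/-!
Write scales as `exp (-t)`. The covering numbers of a homogeneous Moran set are governed by a
single function `f`, which interpolates `n d log 2` at the logarithmic scales of the cubes of level
`n`: the pieces of the set in balls of radius `exp (-s)` need about `exp (f t - f s)` balls of
radius `exp (-t)`. Hence the Assouad dimension is the largest asymptotic slope of `f`, and the
Assouad spectrum at `θ` is the largest asymptotic slope of `f` over the intervals `[θ t, t]`.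
Conversely, every unbounded monotone `f` that vanishes on `(-∞, 0]` and has slopes at most `d`
arises in this way.

It remains to construct `f`. Around each of a sparse sequence of places `T`, let `f` grow by
exactly `T (1 - θ) φ(θ)` on `[θ T, T]`. The two inequalities defining `𝒜_d` say precisely that this
`f` is monotone and that `f t - f (θ t) ≤ t (1 - θ) φ(θ)` at all the other places `t`. They also
imply that `φ` tends to its supremum at `1`, which is the largest slope obtained so far. A segment
of slope `α` whose length is unbounded but at most `√T` is then inserted after `T`: it raises the
Assouad dimension to `α` and is too short to affect the spectrum.
-/

noncomputable section

namespace AssouadSpectra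

/-! ### Covering numbers and profiles -/

lemma coverNum_le {d : ℕ} {δ : ℝ} {F : Set (E d)} {t : Finset (E d)}
    (h : F ⊆ ⋃ x ∈ t, Metric.ball x δ) : coverNum δ F ≤ t.card :=
  Nat.sInf_le ⟨t, rfl, h⟩

lemma one_le_coverNum {d : ℕ} {δ : ℝ} (hδ : 0 < δ) {F : Set (E d)} (hF : Bornology.IsBounded F)
    (hne : F.Nonempty) : 1 ≤ coverNum δ F := by
  obtain ⟨centers, hcard, hcover⟩ := exists_cover hδ hF
  obtain ⟨y, hy, -⟩ := mem_iUnion₂.1 (hcover hne.some_mem)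
  exact hcard ▸ Finset.card_pos.2 ⟨y, hy⟩

/-- `f` is a covering profile of `F` if, up to a multiplicative constant, `exp (f t - f s)` is the
largest number of balls of radius `exp (-t)` needed to cover a piece `F ∩ B(x, exp (-s))`. In
logarithmic scales the exponents in the definitions of the Assouad dimension and spectrum become
average slopes of `f`. -/
def HasCoveringProfile {d : ℕ} (F : Set (E d)) (f : ℝ → ℝ) : Prop :=
  ∃ M > 0, ∀ s t, s ≤ t →
    (∀ x ∈ F, (coverNum (Real.exp (-t)) (F ∩ Metric.ball x (Real.exp (-s))) : ℝ) ≤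
      M * Real.exp (f t - f s)) ∧
    ∃ x ∈ F, Real.exp (f t - f s) ≤
      M * coverNum (Real.exp (-t)) (F ∩ Metric.ball x (Real.exp (-s)))

/-- The slopes that the growth of `f` over an interval never exceeds, up to an additive error;
their infimum is the Assouad dimension of a set with covering profile `f`. -/
def slopeExponents (f : ℝ → ℝ) : Set ℝ :=
  {a | ∃ L, ∀ s t, s < t → f t - f s ≤ a * (t - s) + L}

/-- The slopes that the growth of `f` over `[θ t, t]` never exceeds, up to an additive error; their
infimum is the Assouad spectrum at `θ` of a set with covering profile `f`. -/
def spectrumExponents (θ : ℝ) (f : ℝ → ℝ) : Set ℝ :=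
  {a | ∃ L, ∀ t, 0 ≤ t → f t - f (θ * t) ≤ a * (t - θ * t) + L}

lemma iInf_coe_eq_of_isGLB {S : Set ℝ} {a : ℝ} (h : IsGLB S a) : ⨅ b ∈ S, (b : EReal) = a := by
  refine le_antisymm (EReal.le_of_forall_lt_iff_le.1 fun b hab => ?_)
    (le_iInf₂ fun b hb => EReal.coe_le_coe_iff.2 (h.1 hb))
  obtain ⟨c, hc, -, hcb⟩ := h.exists_between (EReal.coe_lt_coe_iff.1 hab)
  exact (iInf₂_le c hc).trans (EReal.coe_le_coe_iff.2 hcb.le)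

lemma exists_eq_exp_neg {δ : ℝ} (hδ : 0 < δ) : ∃ t, δ = Real.exp (-t) :=
  ⟨-Real.log δ, by rw [neg_neg, Real.exp_log hδ]⟩

lemma exp_neg_div_exp_neg_rpow (s t a : ℝ) :
    (Real.exp (-s) / Real.exp (-t)) ^ a = Real.exp (a * (t - s)) := by
  rw [← Real.exp_sub, ← Real.exp_mul]
  ring_nf

namespace HasCoveringProfile

variable {d : ℕ} {F : Set (E d)} {f : ℝ → ℝ}

lemma exists_coverNum_le_iff (hF : HasCoveringProfile F f) {R : ℝ → ℝ → Prop}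
    (hR : ∀ s t, R s t → s ≤ t) (a : ℝ) :
    (∃ C : ℝ, 0 < C ∧ ∀ s t, R s t → ∀ x ∈ F,
      (coverNum (Real.exp (-t)) (F ∩ Metric.ball x (Real.exp (-s))) : ℝ) ≤
        C * Real.exp (a * (t - s))) ↔
    ∃ L, ∀ s t, R s t → f t - f s ≤ a * (t - s) + L := by
  obtain ⟨M, hM, hF⟩ := hF
  constructor
  · rintro ⟨C, hC, h⟩
    refine ⟨Real.log (M * C), fun s t hst => ?_⟩
    obtain ⟨x, hx, hlow⟩ := (hF s t (hR s t hst)).2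
    rw [← Real.exp_le_exp, Real.exp_add, Real.exp_log (by positivity)]
    calc Real.exp (f t - f s) ≤ M * (C * Real.exp (a * (t - s))) :=
          hlow.trans (by gcongr; exact h s t hst x hx)
      _ = Real.exp (a * (t - s)) * (M * C) := by ring
  · rintro ⟨L, h⟩
    refine ⟨M * Real.exp L, by positivity, fun s t hst x hx => ?_⟩
    calc (coverNum (Real.exp (-t)) (F ∩ Metric.ball x (Real.exp (-s))) : ℝ)
        ≤ M * Real.exp (f t - f s) := (hF s t (hR s t hst)).1 x hx
      _ ≤ M * Real.exp (a * (t - s) + L) := by gcongr; exact h s t hst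
      _ = M * Real.exp L * Real.exp (a * (t - s)) := by rw [Real.exp_add]; ring

theorem assouadDim_eq (hF : HasCoveringProfile F f) :
    assouadDim F = ⨅ a ∈ slopeExponents f, (a : EReal) := by
  have hset : {a : ℝ | ∃ C : ℝ, 0 < C ∧ ∀ δ' δ : ℝ, 0 < δ' → δ' < δ → ∀ x ∈ F,
      (coverNum δ' (F ∩ Metric.ball x δ) : ℝ) ≤ C * (δ / δ') ^ a} = slopeExponents f := by
    ext a
    refine Iff.trans ?_ (hF.exists_coverNum_le_iff (fun s t => le_of_lt) a)
    refine exists_congr fun C => and_congr_right fun _ => ⟨fun h s t hst x hx => ?_,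
      fun h δ' δ hδ' hδ x hx => ?_⟩
    · rw [← exp_neg_div_exp_neg_rpow]
      exact h _ _ (Real.exp_pos _) (Real.exp_lt_exp.2 (neg_lt_neg hst)) x hx
    · obtain ⟨t, rfl⟩ := exists_eq_exp_neg hδ'
      obtain ⟨s, rfl⟩ := exists_eq_exp_neg (hδ'.trans hδ)
      rw [exp_neg_div_exp_neg_rpow]
      exact h s t (neg_lt_neg_iff.1 (Real.exp_lt_exp.1 hδ)) x hx
  rw [assouadDim, hset]

theorem assouadSpectrum_eq (hF : HasCoveringProfile F f) {θ : ℝ} (hθ : θ ∈ Ioo (0 : ℝ) 1) :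
    assouadSpectrum θ F = ⨅ a ∈ spectrumExponents θ f, (a : EReal) := by
  have hpow (t : ℝ) : Real.exp (-(θ * t)) ^ (1 / θ) = Real.exp (-t) := by
    rw [← Real.exp_mul]
    congr 1
    field_simp [hθ.1.ne']
  have hset : {a : ℝ | ∃ C : ℝ, 0 < C ∧ ∀ δ : ℝ, 0 < δ → δ ≤ 1 → ∀ x ∈ F,
      (coverNum (δ ^ (1 / θ)) (F ∩ Metric.ball x δ) : ℝ) ≤ C * (δ / δ ^ (1 / θ)) ^ a} =
      spectrumExponents θ f := by
    ext a
    have key := hF.exists_coverNum_le_iff (R := fun s t => 0 ≤ t ∧ s = θ * t)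
      (fun s t ⟨ht, hs⟩ => hs.trans_le (mul_le_of_le_one_left ht hθ.2.le)) a
    refine (exists_congr fun C => and_congr_right fun _ => ⟨?_, fun h δ hδ hδ1 x hx => ?_⟩).trans
      (key.trans (exists_congr fun L => ⟨fun h t ht => h _ t ⟨ht, rfl⟩, ?_⟩))
    · rintro h _ t ⟨ht, rfl⟩ x hx
      have hs : Real.exp (-(θ * t)) ≤ 1 :=
        Real.exp_le_one_iff.2 (neg_nonpos.2 (mul_nonneg hθ.1.le ht))
      simpa only [hpow, exp_neg_div_exp_neg_rpow] using h _ (Real.exp_pos _) hs x hx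
    · obtain ⟨s, rfl⟩ := exists_eq_exp_neg hδ
      obtain ⟨t, rfl⟩ : ∃ t, s = θ * t := ⟨s / θ, by field_simp [hθ.1.ne']⟩
      have ht : 0 ≤ t :=
        nonneg_of_mul_nonneg_right (neg_nonpos.1 (Real.exp_le_one_iff.1 hδ1)) hθ.1
      simpa only [hpow, exp_neg_div_exp_neg_rpow] using h _ t ⟨ht, rfl⟩ x hx
    · rintro h _ t ⟨ht, rfl⟩
      exact h t ht
  rw [assouadSpectrum, hset]

end HasCoveringProfile

/-! ### Geometry of homogeneous Moran sets -/

/-- The side length of the cubes of level `n`. -/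
def sideLength (r : ℕ → ℝ) (n : ℕ) : ℝ := ∏ i ∈ Finset.range n, r i

/-- The corner nearest to the origin of the cube coded by the word `σ`. -/
def corner {d : ℕ} (r : ℕ → ℝ) {n : ℕ} (σ : Fin n → (Fin d → Bool)) : E d :=
  WithLp.toLp 2 fun j => ∑ i, if σ i j then sideLength r i - sideLength r (i + 1) else 0

/-- The cube `S_σ([0,1]^d)` coded by the word `σ`, see `image_wordMap_unitCube`. -/
def cube {d : ℕ} (r : ℕ → ℝ) {n : ℕ} (σ : Fin n → (Fin d → Bool)) : Set (E d) :=
  {y | ∀ j, y j - corner r σ j ∈ Icc 0 (sideLength r n)}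

open Classical in
/-- The words of length `n` whose cubes are close to the point `x`. -/
def nearWords {d : ℕ} (r : ℕ → ℝ) (n : ℕ) (x : E d) : Finset (Fin n → (Fin d → Bool)) :=
  {σ | ∀ j, |corner r σ j - x j| ≤ 2 * sideLength r n}

lemma sideLength_succ (r : ℕ → ℝ) (n : ℕ) : sideLength r (n + 1) = sideLength r n * r n :=
  Finset.prod_range_succ _ _

section Geometry

variable {d : ℕ} {r : ℕ → ℝ}

lemma corner_apply {n : ℕ} (σ : Fin n → (Fin d → Bool)) (j : Fin d) :
    corner r σ j = ∑ i, if σ i j then sideLength r i - sideLength r (i + 1) else 0 := rfl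

lemma corner_succ_apply {n : ℕ} (σ : Fin (n + 1) → (Fin d → Bool)) (j : Fin d) :
    corner r σ j = corner r (Fin.init σ) j +
      if σ (Fin.last n) j then sideLength r n - sideLength r (n + 1) else 0 :=
  Fin.sum_univ_castSucc _

lemma corner_append_apply {n k : ℕ} (σ : Fin n → (Fin d → Bool)) (τ : Fin k → (Fin d → Bool))
    (j : Fin d) : corner r (Fin.append σ τ) j = corner r σ j +
      ∑ i, if τ i j then sideLength r (n + i) - sideLength r (n + i + 1) else 0 := by
  simp only [corner_apply, Fin.sum_univ_add, Fin.append_left, Fin.append_right, Fin.val_castAdd,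
    Fin.val_natAdd]

lemma corner_false (n : ℕ) : corner r (fun (_ : Fin n) (_ : Fin d) => false) = 0 := by
  ext j
  simp [corner_apply]

lemma corner_append_false {n : ℕ} (σ : Fin n → (Fin d → Bool)) (k : ℕ) :
    corner r (Fin.append σ fun (_ : Fin k) _ => false) = corner r σ := by
  ext j
  simp [corner_append_apply]

lemma wordMap_apply {n : ℕ} (σ : Fin n → (Fin d → Bool)) (x : E d) (j : Fin d) :
    wordMap r n σ x j = sideLength r n * x j + corner r σ j := by
  induction n generalizing x with
  | zero => simp [wordMap, corner, sideLength]
  | succ n ih =>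
    rw [wordMap, Function.comp_apply, ih, corner_succ_apply, sideLength_succ]
    simp only [moranMap, PiLp.add_apply, PiLp.smul_apply, smul_eq_mul]
    split_ifs <;> ring

lemma dist_corner_le_of_mem_cube {n : ℕ} {σ : Fin n → (Fin d → Bool)} {y : E d}
    (hy : y ∈ cube r σ) (hn : 0 ≤ sideLength r n) :
    dist y (corner r σ) ≤ √d * sideLength r n := by
  rw [EuclideanSpace.dist_eq]
  calc √(∑ j, dist (y j) (corner r σ j) ^ 2) ≤ √(∑ _j : Fin d, sideLength r n ^ 2) := by
        gcongr with j
        rw [Real.dist_eq, abs_of_nonneg (hy j).1]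
        exact (hy j).2
    _ = √d * sideLength r n := by
        rw [Finset.sum_const, Finset.card_univ, Fintype.card_fin, nsmul_eq_mul,
          Real.sqrt_mul d.cast_nonneg, Real.sqrt_sq hn]

lemma mem_nearWords_of_mem_cube {n : ℕ} {σ : Fin n → (Fin d → Bool)} {x y : E d}
    (hy : y ∈ cube r σ) (hyx : dist y x ≤ sideLength r n) : σ ∈ nearWords r n x := by
  refine Finset.mem_filter.2 ⟨Finset.mem_univ σ, fun j => ?_⟩
  have hcoord : |y j - x j| ≤ dist y x := by
    simpa [dist_eq_norm] using PiLp.norm_apply_le (y - x) j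
  have hj := abs_le.1 (hcoord.trans hyx)
  rw [abs_le]
  constructor <;> linarith [(hy j).1, (hy j).2]

variable (hr : ∀ n, r n ∈ Ioc (0 : ℝ) (1 / 2))
include hr

lemma sideLength_pos (n : ℕ) : 0 < sideLength r n := Finset.prod_pos fun i _ => (hr i).1

lemma two_mul_sideLength_succ_le (n : ℕ) : 2 * sideLength r (n + 1) ≤ sideLength r n := by
  rw [sideLength_succ]
  nlinarith [sideLength_pos hr n, (hr n).2]

lemma antitone_sideLength : Antitone (sideLength r) :=
  antitone_nat_of_succ_le fun n => by
    linarith [two_mul_sideLength_succ_le hr n, sideLength_pos hr (n + 1)]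

lemma image_wordMap_unitCube {n : ℕ} (σ : Fin n → (Fin d → Bool)) :
    wordMap r n σ '' unitCube d = cube r σ := by
  have hpos := sideLength_pos hr n
  ext y
  constructor
  · rintro ⟨x, hx, rfl⟩ j
    rw [wordMap_apply, add_sub_cancel_right]
    exact ⟨mul_nonneg hpos.le (hx j).1, mul_le_of_le_one_right hpos.le (hx j).2⟩
  · intro hy
    refine ⟨(sideLength r n)⁻¹ • (y - corner r σ), fun j => ?_, ?_⟩
    · rw [PiLp.smul_apply, PiLp.sub_apply, smul_eq_mul, inv_mul_eq_div]
      exact ⟨div_nonneg (hy j).1 hpos.le, div_le_one_of_le₀ (hy j).2 hpos.le⟩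
    · ext j
      rw [wordMap_apply, PiLp.smul_apply, PiLp.sub_apply, smul_eq_mul,
        mul_inv_cancel_left₀ hpos.ne', sub_add_cancel]

lemma corner_append_sub_mem_Icc {n k : ℕ} (σ : Fin n → (Fin d → Bool))
    (τ : Fin k → (Fin d → Bool)) (j : Fin d) :
    corner r (Fin.append σ τ) j - corner r σ j ∈ Icc 0 (sideLength r n - sideLength r (n + k)) := by
  have hstep (i : ℕ) : 0 ≤ sideLength r (n + i) - sideLength r (n + i + 1) :=
    sub_nonneg.2 (antitone_sideLength hr (n + i).le_succ)
  rw [corner_append_apply, add_sub_cancel_left]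
  constructor
  · exact Finset.sum_nonneg fun i _ => by split_ifs <;> simp [hstep]
  · calc ∑ i : Fin k, (if τ i j then sideLength r (n + i) - sideLength r (n + i + 1) else 0)
        ≤ ∑ i : Fin k, (sideLength r (n + i) - sideLength r (n + i + 1)) :=
          Finset.sum_le_sum fun i _ => by split_ifs <;> simp [hstep]
      _ = sideLength r n - sideLength r (n + k) := by
          rw [Fin.sum_univ_eq_sum_range fun i => sideLength r (n + i) - sideLength r (n + i + 1)]
          exact Finset.sum_range_sub' (fun i => sideLength r (n + i)) k

lemma cube_append_subset {n k : ℕ} (σ : Fin n → (Fin d → Bool)) (τ : Fin k → (Fin d → Bool)) :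
    cube r (Fin.append σ τ) ⊆ cube r σ := fun y hy j => by
  have h := corner_append_sub_mem_Icc hr σ τ j
  exact ⟨by linarith [h.1, (hy j).1], by linarith [h.2, (hy j).2]⟩

lemma mem_moranSet_iff {y : E d} :
    y ∈ moranSet d r ↔ ∀ n, ∃ σ : Fin n → (Fin d → Bool), y ∈ cube r σ := by
  simp only [moranSet, image_wordMap_unitCube hr, mem_iInter, mem_iUnion]
  refine ⟨fun h n => ?_, fun h n => h (n + 1)⟩
  obtain ⟨σ, hσ⟩ := h n
  rw [← Fin.append_castAdd_natAdd (f := σ)] at hσ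
  exact ⟨_, cube_append_subset hr _ _ hσ⟩

lemma corner_mem_cube {n : ℕ} (σ : Fin n → (Fin d → Bool)) : corner r σ ∈ cube r σ := fun j => by
  rw [sub_self]
  exact left_mem_Icc.2 (sideLength_pos hr n).le

lemma corner_mem_moranSet {n : ℕ} (σ : Fin n → (Fin d → Bool)) : corner r σ ∈ moranSet d r := by
  refine (mem_moranSet_iff hr).2 fun m => ?_
  rcases le_total n m with h | h <;> obtain ⟨k, rfl⟩ := Nat.exists_eq_add_of_le h
  · exact ⟨_, corner_append_false σ k ▸ corner_mem_cube hr _⟩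
  · rw [← Fin.append_castAdd_natAdd (f := σ)]
    exact ⟨_, cube_append_subset hr _ _ (corner_mem_cube hr _)⟩

lemma zero_mem_moranSet : (0 : E d) ∈ moranSet d r :=
  corner_false (r := r) (d := d) 0 ▸ corner_mem_moranSet hr _

lemma sideLength_le_abs_corner_sub {n : ℕ} {σ τ : Fin n → (Fin d → Bool)} {j : Fin d}
    (h : ∃ i, σ i j ≠ τ i j) : sideLength r n ≤ |corner r σ j - corner r τ j| := by
  induction n with
  | zero => exact h.choose.elim0
  | succ n ih =>
    have hpos := sideLength_pos hr (n + 1)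
    have htwo := two_mul_sideLength_succ_le hr n
    rw [corner_succ_apply, corner_succ_apply, le_abs]
    by_cases hinit : ∃ i, Fin.init σ i j ≠ Fin.init τ i j
    · rcases le_abs.1 (ih hinit) with hle | hle
      · left
        split_ifs <;> linarith
      · right
        split_ifs <;> linarith
    · push Not at hinit
      have hcorner : corner r (Fin.init σ) j = corner r (Fin.init τ) j := by
        simp only [corner_apply, hinit]
      have hlast : σ (Fin.last n) j ≠ τ (Fin.last n) j := fun hlast =>
        h.elim fun i hi => hi (Fin.lastCases hlast hinit i)
      rw [hcorner]
      cases hσ : σ (Fin.last n) j <;> cases hτ : τ (Fin.last n) j <;>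
        simp only [hσ, hτ, ne_eq, not_true_eq_false, if_true, Bool.false_eq_true, if_false]
          at hlast ⊢
      · right; linarith
      · left; linarith

/-- The corners of distinct words of length `n` lie in distinct cells of the grid of mesh
`sideLength r n` based at `x`. -/
lemma card_nearWords_le (n : ℕ) (x : E d) : (nearWords r n x).card ≤ 5 ^ d := by
  have hpos := sideLength_pos hr n
  have hcard : (Fintype.piFinset fun _ : Fin d => Finset.Icc (-2 : ℤ) 2).card = 5 ^ d := by simp
  rw [← hcard]
  refine Finset.card_le_card_of_injOn
    (fun σ j => ⌊(corner r σ j - x j) / sideLength r n⌋) (fun σ hσ => ?_) fun σ _ τ _ hστ => ?_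
  · refine Fintype.mem_piFinset.2 fun j => Finset.mem_Icc.2 ?_
    have hj := abs_le.1 ((Finset.mem_filter.1 hσ).2 j)
    constructor
    · rw [Int.le_floor, le_div_iff₀ hpos]
      push_cast
      linarith
    · rw [← Int.lt_add_one_iff, Int.floor_lt, div_lt_iff₀ hpos]
      push_cast
      linarith
  · by_contra hne
    obtain ⟨i, hi⟩ := Function.ne_iff.1 hne
    obtain ⟨j, hj⟩ := Function.ne_iff.1 hi
    have hsep := sideLength_le_abs_corner_sub hr ⟨i, hj⟩
    have hfloor := Int.abs_sub_lt_one_of_floor_eq_floor (congrFun hστ j)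
    rw [← sub_div, abs_div, abs_of_pos hpos, div_lt_one hpos, sub_sub_sub_cancel_right] at hfloor
    linarith

lemma coverNum_moranSet_inter_ball_le {n k : ℕ} {δ δ' : ℝ} (hn : n = 0 ∨ δ ≤ sideLength r n)
    (hδ' : √d * sideLength r (n + k) < δ') (x : E d) :
    coverNum δ' (moranSet d r ∩ Metric.ball x δ) ≤ 5 ^ d * 2 ^ (d * k) := by
  classical
  obtain ⟨W, hWcard, hW⟩ : ∃ W : Finset (Fin n → (Fin d → Bool)), W.card ≤ 5 ^ d ∧
      ∀ σ, ∀ y ∈ cube r σ, y ∈ Metric.ball x δ → σ ∈ W := by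
    rcases hn with rfl | hn
    · exact ⟨Finset.univ, (Finset.card_le_one_of_subsingleton _).trans (by simp [Nat.one_le_pow]),
        fun σ _ _ _ => Finset.mem_univ σ⟩
    · refine ⟨nearWords r n x, card_nearWords_le hr n x, fun σ y hy hyx => ?_⟩
      exact mem_nearWords_of_mem_cube hy ((Metric.mem_ball.1 hyx).le.trans hn)
  let centers := (W ×ˢ (Finset.univ : Finset (Fin k → (Fin d → Bool)))).image fun p =>
    corner r (Fin.append p.1 p.2)
  calc coverNum δ' (moranSet d r ∩ Metric.ball x δ) ≤ centers.card := coverNum_le ?_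
    _ ≤ W.card * 2 ^ (d * k) := by
      refine Finset.card_image_le.trans_eq ?_
      simp [Finset.card_product, pow_mul]
    _ ≤ 5 ^ d * 2 ^ (d * k) := Nat.mul_le_mul_right _ hWcard
  rintro y ⟨hy, hyx⟩
  obtain ⟨σ, hσ⟩ := (mem_moranSet_iff hr).1 hy (n + k)
  rw [← Fin.append_castAdd_natAdd (f := σ)] at hσ
  have hprefix := hW _ y (cube_append_subset hr _ _ hσ) hyx
  exact mem_iUnion₂.2 ⟨_,
    Finset.mem_image_of_mem _ (Finset.mk_mem_product hprefix (Finset.mem_univ _)),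
    (dist_corner_le_of_mem_cube hσ (sideLength_pos hr _).le).trans_lt hδ'⟩

lemma two_pow_le_coverNum_moranSet_inter_ball {n k : ℕ} {δ δ' : ℝ} (hδ'pos : 0 < δ')
    (hδ : √d * sideLength r n < δ) (hδ' : δ' ≤ sideLength r (n + k)) :
    2 ^ (d * k) ≤ coverNum δ' (moranSet d r ∩ Metric.ball 0 δ) * 5 ^ d := by
  classical
  obtain ⟨centers, hcard, hcover⟩ := exists_cover hδ'pos
    (Metric.isBounded_ball.subset (inter_subset_right (s := moranSet d r) (t := Metric.ball 0 δ)))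
  let words := Finset.univ.image fun τ : Fin k → (Fin d → Bool) =>
    Fin.append (fun (_ : Fin n) _ => false) τ
  have hwords : words.card = 2 ^ (d * k) := by
    have hinj : Function.Injective fun τ : Fin k → (Fin d → Bool) =>
        Fin.append (fun (_ : Fin n) _ => false) τ :=
      fun τ τ' h => funext fun i => by simpa using congrFun h (Fin.natAdd n i)
    rw [Finset.card_image_of_injective _ hinj]
    simp [pow_mul]
  have hnear : words ⊆ centers.biUnion (nearWords r (n + k)) := fun σ hσ => by
    obtain ⟨τ, -, rfl⟩ := Finset.mem_image.1 hσ
    have hcube := cube_append_subset hr (fun (_ : Fin n) _ => false) τ (corner_mem_cube hr _)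
    have hball := dist_corner_le_of_mem_cube hcube (sideLength_pos hr n).le
    rw [corner_false] at hball
    obtain ⟨y, hy, hyball⟩ := mem_iUnion₂.1
      (hcover ⟨corner_mem_moranSet hr _, Metric.mem_ball.2 (hball.trans_lt hδ)⟩)
    exact Finset.mem_biUnion.2 ⟨y, hy, mem_nearWords_of_mem_cube (corner_mem_cube hr _)
      ((Metric.mem_ball.1 hyball).le.trans hδ')⟩
  calc 2 ^ (d * k) = words.card := hwords.symm
    _ ≤ (centers.biUnion (nearWords r (n + k))).card := Finset.card_le_card hnear
    _ ≤ centers.card * 5 ^ d :=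
      Finset.card_biUnion_le_card_mul _ _ _ fun y _ => card_nearWords_le hr _ y
    _ = _ := by rw [hcard]

end Geometry

/-! ### Moran sets with a prescribed covering profile -/

section PrescribedProfile

variable {d : ℕ} {r : ℕ → ℝ} {f : ℝ → ℝ}

/-- `f` interpolates the logarithms of the numbers `2 ^ (d * n)` of cubes of level `n` between the
logarithmic scales `-log (sideLength r n)` of these cubes, with slopes between `0` and `d`. -/
structure InterpolatesLevels (d : ℕ) (r : ℕ → ℝ) (f : ℝ → ℝ) : Prop where
  ratio_mem : ∀ n, r n ∈ Ioc (0 : ℝ) (1 / 2)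
  monotone : Monotone f
  antitone_sub : Antitone fun t => f t - d * t
  nonneg : ∀ t, 0 ≤ f t
  apply_neg_log : ∀ n : ℕ, f (-Real.log (sideLength r n)) = n * (d * Real.log 2)

namespace InterpolatesLevels

lemma exists_sideLength_lt (hf : InterpolatesLevels d r f) (hd : 0 < d) (t : ℝ) :
    ∃ n : ℕ, sideLength r n < Real.exp (-t) ∧
      n * (d * Real.log 2) ∈ Ioc (f t) (f t + d * Real.log 2) := by
  have hc : 0 < d * Real.log 2 := by positivity
  have hfloor := Nat.floor_le (div_nonneg (hf.nonneg t) hc.le)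
  have hlt := Nat.lt_floor_add_one (f t / (d * Real.log 2))
  rw [le_div_iff₀ hc] at hfloor
  rw [div_lt_iff₀ hc] at hlt
  refine ⟨⌊f t / (d * Real.log 2)⌋₊ + 1, ?_, by exact_mod_cast hlt, by push_cast; linarith⟩
  rw [← Real.log_lt_iff_lt_exp (sideLength_pos hf.ratio_mem _), lt_neg]
  refine hf.monotone.reflect_lt ?_
  rw [hf.apply_neg_log]
  exact_mod_cast hlt

lemma exists_le_sideLength (hf : InterpolatesLevels d r f) (hd : 0 < d) (t : ℝ) :
    ∃ n : ℕ, (n = 0 ∨ Real.exp (-t) ≤ sideLength r n) ∧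
      f t ∈ Icc (n * (d * Real.log 2)) (n * (d * Real.log 2) + d * Real.log 2) := by
  have hc : 0 < d * Real.log 2 := by positivity
  have hceil := Nat.le_ceil (f t / (d * Real.log 2))
  rw [div_le_iff₀ hc] at hceil
  rcases Nat.eq_zero_or_eq_succ_pred ⌈f t / (d * Real.log 2)⌉₊ with h | h
  · rw [h, Nat.cast_zero, zero_mul] at hceil
    refine ⟨0, Or.inl rfl, ?_⟩
    simpa using ⟨hf.nonneg t, hceil.trans hc.le⟩
  · set n := Nat.pred ⌈f t / (d * Real.log 2)⌉₊
    have hlt : n * (d * Real.log 2) < f t := by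
      rw [← lt_div_iff₀ hc]
      exact Nat.lt_ceil.1 (h ▸ n.lt_succ_self)
    refine ⟨n, Or.inr ?_, hlt.le, ?_⟩
    · rw [← Real.le_log_iff_exp_le (sideLength_pos hf.ratio_mem _), neg_le]
      refine (hf.monotone.reflect_lt ?_).le
      rwa [hf.apply_neg_log]
    · rw [h] at hceil
      push_cast at hceil
      linarith

end InterpolatesLevels

lemma exp_mul_log_two (d k : ℕ) : Real.exp (k * (d * Real.log 2)) = 2 ^ (d * k) := by
  rw [← mul_assoc, mul_comm (k : ℝ), ← Nat.cast_mul, Real.exp_nat_mul, Real.exp_log two_pos]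

lemma sqrt_mul_lt_exp_neg {x y t : ℝ} (hx : 0 < x)
    (h : x < Real.exp (-(t + Real.log (√y + 1)))) : √y * x < Real.exp (-t) := by
  have hy : 0 < √y + 1 := by positivity
  rw [neg_add, Real.exp_add, Real.exp_neg (Real.log _), Real.exp_log hy, ← div_eq_mul_inv,
    lt_div_iff₀ hy] at h
  linarith

namespace InterpolatesLevels

lemma apply_add_le (hf : InterpolatesLevels d r f) (t : ℝ) {q : ℝ} (hq : 0 ≤ q) :
    f (t + q) ≤ f t + d * q := by
  have h := hf.antitone_sub (le_add_of_nonneg_right hq : t ≤ t + q)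
  simp only [mul_add] at h
  linarith

lemma coverNum_moranSet_le (hf : InterpolatesLevels d r f) (hd : 0 < d) {s t : ℝ} (hst : s ≤ t)
    (x : E d) :
    (coverNum (Real.exp (-t)) (moranSet d r ∩ Metric.ball x (Real.exp (-s))) : ℝ) ≤
      5 ^ d * Real.exp (2 * (d * Real.log 2) + d * Real.log (√d + 1)) * Real.exp (f t - f s) := by
  have hq : 0 ≤ Real.log (√d + 1) := Real.log_nonneg (by linarith [Real.sqrt_nonneg (d : ℝ)])
  have hc : 0 < d * Real.log 2 := by positivity
  obtain ⟨n, hn, hns⟩ := hf.exists_le_sideLength hd s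
  obtain ⟨m, hm, hmt⟩ := hf.exists_sideLength_lt hd (t + Real.log (√d + 1))
  have hnm : n ≤ m := by
    have hfst := hf.monotone (by linarith : s ≤ t + Real.log (√d + 1))
    exact_mod_cast (lt_of_mul_lt_mul_right (hns.1.trans_lt (hfst.trans_lt hmt.1)) hc.le).le
  obtain ⟨k, rfl⟩ := Nat.exists_eq_add_of_le hnm
  calc (coverNum (Real.exp (-t)) (moranSet d r ∩ Metric.ball x (Real.exp (-s))) : ℝ)
      ≤ 5 ^ d * 2 ^ (d * k) := by
        exact_mod_cast coverNum_moranSet_inter_ball_le hf.ratio_mem hn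
          (sqrt_mul_lt_exp_neg (sideLength_pos hf.ratio_mem _) hm) x
    _ ≤ 5 ^ d * Real.exp (2 * (d * Real.log 2) + d * Real.log (√d + 1) + (f t - f s)) := by
        rw [← exp_mul_log_two]
        gcongr
        have := hmt.2
        push_cast at this
        linarith [hf.apply_add_le t hq, hns.2]
    _ = _ := by rw [Real.exp_add, mul_assoc]

lemma exp_le_coverNum_moranSet (hf : InterpolatesLevels d r f) (hd : 0 < d) (s t : ℝ) :
    Real.exp (f t - f s) ≤ 5 ^ d * Real.exp (2 * (d * Real.log 2) + d * Real.log (√d + 1)) *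
      coverNum (Real.exp (-t)) (moranSet d r ∩ Metric.ball 0 (Real.exp (-s))) := by
  have hq : 0 ≤ Real.log (√d + 1) := Real.log_nonneg (by linarith [Real.sqrt_nonneg (d : ℝ)])
  have hc : 0 < d * Real.log 2 := by positivity
  obtain ⟨n, hn, hns⟩ := hf.exists_sideLength_lt hd (s + Real.log (√d + 1))
  obtain ⟨m, hm, hmt⟩ := hf.exists_le_sideLength hd t
  have hlevels : Real.exp (m * (d * Real.log 2) - n * (d * Real.log 2)) ≤
      5 ^ d * coverNum (Real.exp (-t)) (moranSet d r ∩ Metric.ball 0 (Real.exp (-s))) := by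
    rcases le_or_gt n m with hnm | hmn
    · have hn0 : (0 : ℝ) < n := pos_of_mul_pos_left ((hf.nonneg _).trans_lt hns.1) hc.le
      have hm' := hm.resolve_left ((Nat.cast_pos.1 hn0).trans_le hnm).ne'
      obtain ⟨k, rfl⟩ := Nat.exists_eq_add_of_le hnm
      rw [Nat.cast_add, ← sub_mul, add_sub_cancel_left, exp_mul_log_two, mul_comm ((5 : ℝ) ^ d)]
      exact_mod_cast two_pow_le_coverNum_moranSet_inter_ball hf.ratio_mem (Real.exp_pos _)
        (sqrt_mul_lt_exp_neg (sideLength_pos hf.ratio_mem _) hn) hm'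
    · have hone := one_le_coverNum (Real.exp_pos (-t))
        (Metric.isBounded_ball.subset (inter_subset_right (s := moranSet d r)))
        ⟨0, zero_mem_moranSet hf.ratio_mem, Metric.mem_ball_self (Real.exp_pos (-s))⟩
      calc Real.exp (m * (d * Real.log 2) - n * (d * Real.log 2)) ≤ 1 :=
            Real.exp_le_one_iff.2 (sub_nonpos.2 (by gcongr))
        _ ≤ _ := one_le_mul_of_one_le_of_one_le (one_le_pow₀ (by norm_num))
            (by exact_mod_cast hone)
  calc Real.exp (f t - f s)
      ≤ Real.exp (2 * (d * Real.log 2) + d * Real.log (√d + 1)) *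
          Real.exp (m * (d * Real.log 2) - n * (d * Real.log 2)) := by
        rw [← Real.exp_add]
        gcongr
        linarith [hf.apply_add_le s hq, hns.2, hmt.2]
    _ ≤ _ := mul_le_mul_of_nonneg_left hlevels (Real.exp_pos _).le
    _ = _ := by ring

theorem hasCoveringProfile (hf : InterpolatesLevels d r f) (hd : 0 < d) :
    HasCoveringProfile (moranSet d r) f :=
  ⟨_, by positivity, fun s t hst => ⟨fun x _ => hf.coverNum_moranSet_le hd hst x,
    0, zero_mem_moranSet hf.ratio_mem, hf.exp_le_coverNum_moranSet hd s t⟩⟩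

end InterpolatesLevels

lemma lipschitzWith_of_monotone_of_antitone_sub (hmono : Monotone f)
    (hlip : Antitone fun t => f t - d * t) : LipschitzWith d f := by
  refine LipschitzWith.of_le_add_mul _ fun x y => ?_
  rcases le_total x y with h | h
  · exact (hmono h).trans (le_add_of_nonneg_right (by positivity))
  · rw [Real.dist_eq, abs_of_nonneg (sub_nonneg.2 h), NNReal.coe_natCast]
    linarith [hlip h]

lemma log_two_le_sub_of_apply_eq (hd : 0 < d) (hmono : Monotone f)
    (hlip : Antitone fun t => f t - d * t) {s t : ℝ} (h : f t = f s + d * Real.log 2) :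
    Real.log 2 ≤ t - s := by
  have hlog : 0 < d * Real.log 2 := by positivity
  have hslope := hlip (hmono.reflect_lt (by linarith : f s < f t)).le
  exact le_of_mul_le_mul_left (by linarith : d * Real.log 2 ≤ d * (t - s)) (Nat.cast_pos.2 hd)

lemma exists_interpolatesLevels (hd : 0 < d) (hmono : Monotone f) (hzero : ∀ t ≤ 0, f t = 0)
    (hlip : Antitone fun t => f t - d * t) (htop : Tendsto f atTop atTop) :
    ∃ r : ℕ → ℝ, InterpolatesLevels d r f := by
  have hnonneg (t : ℝ) : 0 ≤ f t :=
    (hzero (min t 0) (min_le_right _ _)).symm.trans_le (hmono (min_le_left _ _))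
  have hcont := (lipschitzWith_of_monotone_of_antitone_sub hmono hlip).continuous
  have htimes (n : ℕ) : ∃ t, f t = n * (d * Real.log 2) ∧ (n = 0 → t = 0) := by
    rcases n.eq_zero_or_pos with rfl | hn
    · exact ⟨0, by simp [hzero 0 le_rfl], fun _ => rfl⟩
    · obtain ⟨T, hT0, hT⟩ := ((eventually_ge_atTop (0 : ℝ)).and
        (htop.eventually_ge_atTop (n * (d * Real.log 2)))).exists
      obtain ⟨t, -, ht⟩ := intermediate_value_Icc hT0 hcont.continuousOn
        (mem_Icc.2 ⟨by rw [hzero 0 le_rfl]; positivity, hT⟩)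
      exact ⟨t, ht, fun h => absurd h hn.ne'⟩
  choose τ hτ hτ0 using htimes
  have hside (n : ℕ) : sideLength (fun n => Real.exp (τ n - τ (n + 1))) n = Real.exp (-τ n) := by
    rw [sideLength, ← Real.exp_sum, Finset.sum_range_sub', hτ0 0 rfl, zero_sub]
  refine ⟨fun n => Real.exp (τ n - τ (n + 1)), fun n => ⟨Real.exp_pos _, ?_⟩, hmono, hlip, hnonneg,
    fun n => by rw [hside, Real.log_exp, neg_neg, hτ]⟩
  have hstep := log_two_le_sub_of_apply_eq hd hmono hlip
    (by rw [hτ, hτ]; push_cast; ring : f (τ (n + 1)) = f (τ n) + d * Real.log 2)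
  rw [← Real.le_log_iff_exp_le (by norm_num), one_div, Real.log_inv]
  linarith

lemma hasCoveringProfile_moranSet_zero (hr : ∀ n, r n ∈ Ioc (0 : ℝ) (1 / 2)) (hf : ∀ t, f t = 0) :
    HasCoveringProfile (moranSet 0 r) f := by
  refine ⟨1, one_pos, fun s t _ => ?_⟩
  simp only [hf, sub_self, Real.exp_zero, mul_one, one_mul]
  refine ⟨fun x _ => ?_, 0, zero_mem_moranSet hr, ?_⟩
  · exact_mod_cast coverNum_le (t := {0}) fun y _ => by
      simpa [Subsingleton.elim y 0] using Real.exp_pos (-t)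
  · have hne : (moranSet 0 r ∩ Metric.ball 0 (Real.exp (-s))).Nonempty :=
      ⟨0, zero_mem_moranSet hr, Metric.mem_ball_self (Real.exp_pos _)⟩
    exact_mod_cast one_le_coverNum (Real.exp_pos _) (toFinite _).isBounded hne

theorem exists_hasCoveringProfile_moranSet (hmono : Monotone f) (hzero : ∀ t ≤ 0, f t = 0)
    (hlip : Antitone fun t => f t - d * t) (htop : 0 < d → Tendsto f atTop atTop) :
    ∃ r : ℕ → ℝ, (∀ n, r n ∈ Ioc (0 : ℝ) (1 / 2)) ∧ HasCoveringProfile (moranSet d r) f := by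
  rcases d.eq_zero_or_pos with rfl | hd
  · have hr (n : ℕ) : (fun _ : ℕ => (1 / 2 : ℝ)) n ∈ Ioc (0 : ℝ) (1 / 2) := by norm_num
    refine ⟨_, hr, hasCoveringProfile_moranSet_zero hr fun t => ?_⟩
    rcases le_total t 0 with ht | ht
    · exact hzero t ht
    · refine le_antisymm ?_ ((hzero 0 le_rfl).symm.trans_le (hmono ht))
      simpa [hzero 0 le_rfl] using hlip ht
  · obtain ⟨r, hr⟩ := exists_interpolatesLevels hd hmono hzero hlip (htop hd)
    exact ⟨r, hr.ratio_mem, hr.hasCoveringProfile hd⟩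

end PrescribedProfile

/-! ### The class `𝒜_d` -/

section ClassA

variable {d : ℕ} {φ : ℝ → ℝ}

/-- The quantity `(1 - θ) φ(θ)` in which the class `𝒜_d` is defined, continued by `0` to `θ ≥ 1`:
the growth prescribed for a covering profile on `[θ t, t]`, divided by `t`. -/
def increment (φ : ℝ → ℝ) (θ : ℝ) : ℝ := max (1 - θ) 0 * φ θ

lemma increment_of_le_one {θ : ℝ} (h : θ ≤ 1) : increment φ θ = (1 - θ) * φ θ := by
  rw [increment, max_eq_left (sub_nonneg.2 h)]

lemma increment_of_one_le {θ : ℝ} (h : 1 ≤ θ) : increment φ θ = 0 := by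
  rw [increment, max_eq_right (sub_nonpos.2 h), zero_mul]

lemma increment_nonneg (hφ : φ ∈ classA d) {θ : ℝ} (h : 0 < θ) : 0 ≤ increment φ θ := by
  rcases lt_or_ge θ 1 with h1 | h1
  · exact mul_nonneg (le_max_right _ _) (hφ.1 θ ⟨h, h1⟩).1
  · exact (increment_of_one_le h1).ge

lemma antitoneOn_increment (hφ : φ ∈ classA d) : AntitoneOn (increment φ) (Ioi 0) := by
  intro s (hs : 0 < s) t _ hst
  rcases lt_or_ge t 1 with h1 | h1
  · rcases hst.eq_or_lt with rfl | hst
    · rfl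
    · rw [increment_of_le_one h1.le, increment_of_le_one (hst.trans h1).le]
      exact sub_nonneg.1 (hφ.2 s t hs hst h1).1
  · rw [increment_of_one_le h1]
    exact increment_nonneg hφ hs

lemma increment_mul_sub_le (hφ : φ ∈ classA d) {θ u : ℝ} (hθ : 0 < θ) (hu : 0 < u) :
    increment φ (θ * u) - increment φ u ≤ u * increment φ θ := by
  have hθu : 0 < θ * u := mul_pos hθ hu
  rcases le_or_gt 1 θ with hθ1 | hθ1
  · rw [increment_of_one_le hθ1, mul_zero, sub_nonpos]
    exact antitoneOn_increment hφ hu hθu (le_mul_of_one_le_left hu.le hθ1)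
  rcases le_or_gt 1 u with hu1 | hu1
  · rw [increment_of_one_le hu1, sub_zero]
    exact (antitoneOn_increment hφ hθ hθu (le_mul_of_one_le_right hθ.le hu1)).trans
      (le_mul_of_one_le_left (increment_nonneg hφ hθ) hu1)
  · have hlt : θ * u < u := mul_lt_of_lt_one_left hu hθ1
    have hclass := (hφ.2 (θ * u) u hθu hlt hu1).2
    rw [mul_div_cancel_right₀ _ hu.ne'] at hclass
    rw [increment_of_le_one (hlt.trans hu1).le, increment_of_le_one hu1.le,
      increment_of_le_one hθ1.le]
    linarith

lemma increment_pow_le (hφ : φ ∈ classA d) {θ : ℝ} (h0 : 0 < θ) (h1 : θ ≤ 1) (n : ℕ) :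
    increment φ (θ ^ n) ≤ (1 - θ ^ n) * φ θ := by
  induction n with
  | zero => simp [increment]
  | succ n ih =>
    have hstep := increment_mul_sub_le hφ h0 (pow_pos h0 n)
    rw [increment_of_le_one h1] at hstep
    rw [pow_succ']
    linarith

lemma one_sub_mul_apply_le (hφ : φ ∈ classA d) {s θ : ℝ} (hs : s ∈ Ioo (0 : ℝ) 1)
    (hθ : θ ∈ Ioo (0 : ℝ) 1) : (1 - s) * φ s ≤ (1 - s * θ) * φ θ := by
  obtain ⟨n, hns, hsn⟩ := exists_nat_pow_near_of_lt_one hs.1 hs.2.le hθ.1 hθ.2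
  calc (1 - s) * φ s = increment φ s := (increment_of_le_one hs.2.le).symm
    _ ≤ increment φ (θ ^ (n + 1)) :=
        antitoneOn_increment hφ (pow_pos hθ.1 _) hs.1 hns.le
    _ ≤ (1 - θ ^ (n + 1)) * φ θ := increment_pow_le hφ hθ.1 hθ.2.le _
    _ ≤ (1 - s * θ) * φ θ := by
        have := (hφ.1 θ hθ).1
        rw [pow_succ]
        gcongr
        exact hθ.1.le

lemma le_sSup_image_of_mem_classA (hφ : φ ∈ classA d) {θ : ℝ} (hθ : θ ∈ Ioo (0 : ℝ) 1) :
    φ θ ≤ sSup (φ '' Ioo 0 1) :=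
  le_csSup ⟨d, forall_mem_image.2 fun t ht => (hφ.1 t ht).2⟩ (mem_image_of_mem φ hθ)

theorem tendsto_sSup_of_mem_classA (hφ : φ ∈ classA d) :
    Tendsto φ (𝓝[<] 1) (𝓝 (sSup (φ '' Ioo 0 1))) := by
  have hIoo : Ioo (0 : ℝ) 1 ∈ 𝓝[<] (1 : ℝ) := Ioo_mem_nhdsLT zero_lt_one
  refine tendsto_order.2 ⟨fun b hb => ?_, fun b hb => ?_⟩
  · obtain ⟨_, ⟨s, hs, rfl⟩, hbs⟩ := exists_lt_of_lt_csSup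
      ((nonempty_Ioo.2 zero_lt_one).image φ) hb
    have hlim : Tendsto (fun θ : ℝ => (1 - s * θ) * b) (𝓝[<] 1) (𝓝 ((1 - s * 1) * b)) :=
      (Continuous.tendsto (by fun_prop) 1).mono_left nhdsWithin_le_nhds
    have hlt : (1 - s * 1) * b < (1 - s) * φ s := by
      rw [mul_one]
      exact mul_lt_mul_of_pos_left hbs (sub_pos.2 hs.2)
    filter_upwards [hlim.eventually_lt_const hlt, hIoo] with θ hθb hθ
    exact lt_of_mul_lt_mul_left (hθb.trans_le (one_sub_mul_apply_le hφ hs hθ))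
      (sub_nonneg.2 (mul_le_one₀ hs.2.le hθ.1.le hθ.2.le))
  · filter_upwards [hIoo] with θ hθ
    exact (le_sSup_image_of_mem_classA hφ hθ).trans_lt hb

lemma nonneg_of_forall_le_of_mem_classA (hφ : φ ∈ classA d) {b : ℝ}
    (hb : ∀ θ ∈ Ioo (0 : ℝ) 1, φ θ ≤ b) : 0 ≤ b := by
  have hhalf : (1 / 2 : ℝ) ∈ Ioo (0 : ℝ) 1 := by norm_num
  exact (hφ.1 _ hhalf).1.trans (hb _ hhalf)

lemma increment_sub_le (hφ : φ ∈ classA d) {b : ℝ} (hb : ∀ θ ∈ Ioo (0 : ℝ) 1, φ θ ≤ b)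
    {u v : ℝ} (hv : 0 < v) (hvu : v ≤ u) : increment φ v - increment φ u ≤ b * (u - v) := by
  rcases hvu.eq_or_lt with rfl | hvu
  · simp
  have hu := hv.trans hvu
  have hratio : v / u ∈ Ioo (0 : ℝ) 1 := ⟨div_pos hv hu, (div_lt_one hu).2 hvu⟩
  calc increment φ v - increment φ u ≤ u * increment φ (v / u) := by
        simpa only [div_mul_cancel₀ v hu.ne'] using increment_mul_sub_le hφ hratio.1 hu
    _ ≤ u * ((1 - v / u) * b) := by
        rw [increment_of_le_one hratio.2.le]
        have := sub_nonneg.2 hratio.2.le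
        gcongr
        exact hb _ hratio
    _ = b * (u - v) := by field_simp

end ClassA

/-! ### Blocks of the profile -/

section Block

/-- The place of the `k`-th block at which the increments prescribed by `φ` are attained. It is
much larger than `(k + 1) ^ 2` and than the preceding places. -/
def blockTop (k : ℕ) : ℝ := ((k + 1).factorial : ℝ) ^ 3

/-- The place at which the `k`-th block starts to grow. -/
def blockStart (k : ℕ) : ℝ := blockTop k / (k + 1)

/-- The place beyond which the `k`-th block is constant. -/
def blockEnd (k : ℕ) : ℝ := blockTop k + (k + 1)

lemma blockTop_succ (k : ℕ) : blockTop (k + 1) = ((k : ℝ) + 2) ^ 3 * blockTop k := by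
  rw [blockTop, blockTop, Nat.factorial_succ (k + 1)]
  push_cast
  ring

lemma sq_le_blockTop (k : ℕ) : ((k : ℝ) + 1) ^ 2 ≤ blockTop k := by
  have hfactorial : (k : ℝ) + 1 ≤ (k + 1).factorial := by
    exact_mod_cast Nat.self_le_factorial (k + 1)
  calc ((k : ℝ) + 1) ^ 2 ≤ (k + 1) ^ 3 :=
        pow_le_pow_right₀ (le_add_of_nonneg_left k.cast_nonneg) (by norm_num)
    _ ≤ blockTop k := pow_le_pow_left₀ (by positivity) hfactorial 3

lemma succ_le_blockStart (k : ℕ) : (k : ℝ) + 1 ≤ blockStart k := by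
  rw [blockStart, le_div_iff₀ (by positivity), ← sq]
  exact sq_le_blockTop k

lemma blockStart_pos (k : ℕ) : 0 < blockStart k :=
  (by positivity : (0 : ℝ) < k + 1).trans_le (succ_le_blockStart k)

lemma blockTop_pos (k : ℕ) : 0 < blockTop k :=
  (by positivity : (0 : ℝ) < (k + 1) ^ 2).trans_le (sq_le_blockTop k)

lemma blockStart_le_blockTop (k : ℕ) : blockStart k ≤ blockTop k :=
  div_le_self (blockTop_pos k).le (le_add_of_nonneg_left k.cast_nonneg)

lemma blockTop_le_blockEnd (k : ℕ) : blockTop k ≤ blockEnd k :=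
  le_add_of_nonneg_right (by positivity)

lemma succ_mul_blockEnd_le (k : ℕ) : ((k : ℝ) + 1) * blockEnd k ≤ blockStart (k + 1) := by
  have hend : blockEnd k ≤ 2 * blockTop k := by
    rw [blockEnd, two_mul]
    gcongr
    exact (succ_le_blockStart k).trans (blockStart_le_blockTop k)
  calc ((k : ℝ) + 1) * blockEnd k ≤ (k + 1) * (2 * blockTop k) := by gcongr
    _ ≤ (k + 2) ^ 2 * blockTop k := by
      rw [← mul_assoc]
      exact mul_le_mul_of_nonneg_right (by nlinarith [k.cast_nonneg (α := ℝ)]) (blockTop_pos k).le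
    _ = blockStart (k + 1) := by
      rw [blockStart, blockTop_succ]
      push_cast
      field_simp
      ring

lemma blockEnd_le_blockStart_succ (k : ℕ) : blockEnd k ≤ blockStart (k + 1) := by
  refine le_trans (le_mul_of_one_le_left ?_ ?_) (succ_mul_blockEnd_le k)
  · exact (blockTop_pos k).le.trans (blockTop_le_blockEnd k)
  · exact le_add_of_nonneg_left k.cast_nonneg

lemma monotone_blockStart : Monotone blockStart :=
  monotone_nat_of_le_succ fun k => (blockStart_le_blockTop k).trans
    ((blockTop_le_blockEnd k).trans (blockEnd_le_blockStart_succ k))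

lemma blockEnd_le_blockStart {j k : ℕ} (h : j < k) : blockEnd j ≤ blockStart k :=
  (blockEnd_le_blockStart_succ j).trans (monotone_blockStart h)

lemma tendsto_blockStart : Tendsto blockStart atTop atTop :=
  tendsto_atTop_mono (fun k => (le_add_of_nonneg_right zero_le_one).trans (succ_le_blockStart k))
    tendsto_natCast_atTop_atTop

variable {d : ℕ} {φ : ℝ → ℝ} {α : ℝ} {k : ℕ} {s t θ : ℝ}

/-- The part of the `k`-th block that realises the increments prescribed by `φ`: for
`1 / (k + 1) ≤ θ ≤ 1` it grows by `blockTop k * increment φ θ` on `[θ * blockTop k, blockTop k]`. -/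
def mainPart (φ : ℝ → ℝ) (k : ℕ) (t : ℝ) : ℝ :=
  blockTop k * (increment φ (1 / (k + 1)) - increment φ (max (1 / (k + 1)) (t / blockTop k)))

lemma one_div_succ_pos (k : ℕ) : (0 : ℝ) < 1 / (k + 1) := by positivity

lemma mainPart_of_le_blockStart (h : t ≤ blockStart k) : mainPart φ k t = 0 := by
  have hle : t / blockTop k ≤ 1 / (k + 1) := by
    rwa [div_le_iff₀ (blockTop_pos k), one_div_mul_eq_div]
  rw [mainPart, max_eq_left hle, sub_self, mul_zero]

lemma mainPart_of_blockTop_le (h : blockTop k ≤ t) :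
    mainPart φ k t = blockTop k * increment φ (1 / (k + 1)) := by
  rw [mainPart, increment_of_one_le (le_max_of_le_right ((one_le_div (blockTop_pos k)).2 h)),
    sub_zero]

lemma mainPart_sub_eq (s t : ℝ) : mainPart φ k t - mainPart φ k s = blockTop k *
    (increment φ (max (1 / (k + 1)) (s / blockTop k)) -
      increment φ (max (1 / (k + 1)) (t / blockTop k))) := by
  rw [mainPart, mainPart]
  ring

lemma monotone_mainPart (hφ : φ ∈ classA d) (k : ℕ) : Monotone (mainPart φ k) := by
  intro s t hst
  have htop := (blockTop_pos k).le
  rw [← sub_nonneg, mainPart_sub_eq]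
  refine mul_nonneg htop (sub_nonneg.2 (antitoneOn_increment hφ ?_ ?_ (by gcongr)))
  all_goals exact lt_max_of_lt_left (one_div_succ_pos k)

lemma antitone_mainPart_sub (hφ : φ ∈ classA d) {b : ℝ} (hb : ∀ θ ∈ Ioo (0 : ℝ) 1, φ θ ≤ b)
    (k : ℕ) : Antitone fun t => mainPart φ k t - b * t := by
  intro s t hst
  have htop := blockTop_pos k
  have hb0 := nonneg_of_forall_le_of_mem_classA hφ hb
  have hdiff : mainPart φ k t - mainPart φ k s ≤ b * (t - s) :=
    calc mainPart φ k t - mainPart φ k s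
        ≤ blockTop k * (b * (max (1 / ((k : ℝ) + 1)) (t / blockTop k) -
            max (1 / ((k : ℝ) + 1)) (s / blockTop k))) := by
          rw [mainPart_sub_eq]
          gcongr
          exact increment_sub_le hφ hb (lt_max_of_lt_left (one_div_succ_pos k)) (by gcongr)
      _ ≤ blockTop k * (b * (t / blockTop k - s / blockTop k)) := by
          gcongr ?_ * (?_ * ?_)
          refine (max_sub_max_le_max _ _ _ _).trans_eq ?_
          rw [sub_self, max_eq_right (sub_nonneg.2 (by gcongr))]
      _ = b * (t - s) := by field_simp
  simp only
  linarith

lemma mainPart_sub_mul_le (hφ : φ ∈ classA d) (k : ℕ) (hθ : θ ∈ Ioc (0 : ℝ) 1) (ht : 0 ≤ t) :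
    mainPart φ k t - mainPart φ k (θ * t) ≤ t * increment φ θ := by
  have htop := blockTop_pos k
  rw [mainPart_sub_eq, mul_div_assoc]
  rcases le_or_gt (t / blockTop k) (1 / (k + 1)) with h | h
  · rw [max_eq_left h, max_eq_left ((mul_le_of_le_one_left (by positivity) hθ.2).trans h),
      sub_self, mul_zero]
    exact mul_nonneg ht (increment_nonneg hφ hθ.1)
  · have hu := (one_div_succ_pos k).trans h
    rw [max_eq_right h.le]
    calc blockTop k * (increment φ (max (1 / (k + 1)) (θ * (t / blockTop k))) -
          increment φ (t / blockTop k))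
        ≤ blockTop k * (increment φ (θ * (t / blockTop k)) - increment φ (t / blockTop k)) := by
          gcongr
          exact antitoneOn_increment hφ (mul_pos hθ.1 hu)
            (lt_max_of_lt_left (one_div_succ_pos k)) (le_max_right _ _)
      _ ≤ blockTop k * (t / blockTop k * increment φ θ) := by
          gcongr
          exact increment_mul_sub_le hφ hθ.1 hu
      _ = t * increment φ θ := by field_simp

lemma mainPart_blockTop_sub (hθ : θ ∈ Icc (1 / ((k : ℝ) + 1)) 1) :
    mainPart φ k (blockTop k) - mainPart φ k (θ * blockTop k) = blockTop k * increment φ θ := by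
  have htop := (blockTop_pos k).ne'
  rw [mainPart_sub_eq, mul_div_cancel_right₀ _ htop, div_self htop, max_eq_right hθ.1,
    increment_of_one_le (le_max_right _ _), sub_zero]

/-- The slope of the `k`-th block beyond `blockTop k`. It is positive for `d > 0`, so that the
profile is unbounded even if `α = 0`. -/
def blockSlope (d : ℕ) (α : ℝ) (k : ℕ) : ℝ := max α (d / (k + 1))

lemma blockSlope_nonneg (d : ℕ) (α : ℝ) (k : ℕ) : 0 ≤ blockSlope d α k :=
  le_max_of_le_right (by positivity)

lemma blockSlope_le (hα : α ≤ d) (k : ℕ) : blockSlope d α k ≤ d :=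
  max_le hα (div_le_self d.cast_nonneg (le_add_of_nonneg_left k.cast_nonneg))

/-- The part of the `k`-th block that realises the Assouad dimension `α`, a segment of slope about
`α` on `[blockTop k, blockEnd k]`. -/
def tailPart (d : ℕ) (α : ℝ) (k : ℕ) (t : ℝ) : ℝ :=
  blockSlope d α k * min ((k : ℝ) + 1) (max 0 (t - blockTop k))

lemma tailPart_of_le_blockTop (h : t ≤ blockTop k) : tailPart d α k t = 0 := by
  rw [tailPart, max_eq_left (sub_nonpos.2 h), min_eq_right (by positivity), mul_zero]

lemma tailPart_of_blockEnd_le (h : blockEnd k ≤ t) :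
    tailPart d α k t = blockSlope d α k * (k + 1) := by
  rw [tailPart, min_eq_left (le_max_of_le_right (le_sub_iff_add_le'.2 h))]

lemma monotone_tailPart (d : ℕ) (α : ℝ) (k : ℕ) : Monotone (tailPart d α k) := by
  intro s t hst
  have := blockSlope_nonneg d α k
  unfold tailPart
  gcongr

lemma tailPart_nonneg (d : ℕ) (α : ℝ) (k : ℕ) (t : ℝ) : 0 ≤ tailPart d α k t :=
  mul_nonneg (blockSlope_nonneg d α k) (le_min (by positivity) (le_max_left _ _))

lemma antitone_tailPart_sub (d : ℕ) (α : ℝ) (k : ℕ) :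
    Antitone fun t => tailPart d α k t - blockSlope d α k * t := by
  intro s t hst
  have hmin : min ((k : ℝ) + 1) (max 0 (t - blockTop k)) - t ≤
      min ((k : ℝ) + 1) (max 0 (s - blockTop k)) - s := by
    grind
  have := mul_le_mul_of_nonneg_left hmin (blockSlope_nonneg d α k)
  simp only [tailPart]
  linarith

lemma tailPart_le_mul_sqrt (hα : α ≤ d) (k : ℕ) (t : ℝ) : tailPart d α k t ≤ d * √t := by
  rcases le_total t (blockTop k) with h | h
  · rw [tailPart_of_le_blockTop h]
    positivity
  · have hsqrt : (k : ℝ) + 1 ≤ √t := Real.le_sqrt_of_sq_le ((sq_le_blockTop k).trans h)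
    exact mul_le_mul (blockSlope_le hα k) ((min_le_left _ _).trans hsqrt)
      (le_min (by positivity) (le_max_left _ _)) d.cast_nonneg

/-- The growth of the profile on its `k`-th block. -/
def block (d : ℕ) (φ : ℝ → ℝ) (α : ℝ) (k : ℕ) (t : ℝ) : ℝ := mainPart φ k t + tailPart d α k t

lemma block_of_le_blockStart (h : t ≤ blockStart k) : block d φ α k t = 0 := by
  rw [block, mainPart_of_le_blockStart h,
    tailPart_of_le_blockTop (h.trans (blockStart_le_blockTop k)), add_zero]

lemma block_eq_of_blockEnd_le (hs : blockEnd k ≤ s) (ht : blockEnd k ≤ t) :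
    block d φ α k s = block d φ α k t := by
  have htop := blockTop_le_blockEnd k
  rw [block, block, mainPart_of_blockTop_le (htop.trans hs),
    mainPart_of_blockTop_le (htop.trans ht), tailPart_of_blockEnd_le hs, tailPart_of_blockEnd_le ht]

lemma monotone_block (hφ : φ ∈ classA d) (α : ℝ) (k : ℕ) : Monotone (block d φ α k) :=
  (monotone_mainPart hφ k).add (monotone_tailPart d α k)

lemma antitone_block_sub (hφ : φ ∈ classA d) (hα : ∀ θ ∈ Ioo (0 : ℝ) 1, φ θ ≤ α) (k : ℕ) :
    Antitone fun t => block d φ α k t - blockSlope d α k * t := by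
  refine AntitoneOn.Iic_union_Ici (a := blockTop k) (fun s hs t ht hst => ?_)
    fun s hs t ht hst => ?_
  · have hmain := antitone_mainPart_sub hφ (fun θ hθ => (hα θ hθ).trans (le_max_left _ _) :
      ∀ θ ∈ Ioo (0 : ℝ) 1, φ θ ≤ blockSlope d α k) k hst
    simpa only [block, tailPart_of_le_blockTop hs, tailPart_of_le_blockTop ht, add_zero]
      using hmain
  · have htail := antitone_tailPart_sub d α k hst
    simp only [block, mainPart_of_blockTop_le hs, mainPart_of_blockTop_le ht] at htail ⊢
    linarith

lemma block_sub_mul_le (hφ : φ ∈ classA d) (hα : α ≤ d) (k : ℕ) (hθ : θ ∈ Ioc (0 : ℝ) 1)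
    (ht : 0 ≤ t) : block d φ α k t - block d φ α k (θ * t) ≤ t * increment φ θ + d * √t := by
  have hmain := mainPart_sub_mul_le hφ k hθ ht
  have htail := tailPart_le_mul_sqrt hα k t
  have hnonneg := tailPart_nonneg d α k (θ * t)
  rw [block, block]
  linarith

lemma block_blockTop_sub (hθ : θ ∈ Icc (1 / ((k : ℝ) + 1)) 1) :
    block d φ α k (blockTop k) - block d φ α k (θ * blockTop k) = blockTop k * increment φ θ := by
  rw [block, block, tailPart_of_le_blockTop le_rfl,
    tailPart_of_le_blockTop (mul_le_of_le_one_left (blockTop_pos k).le hθ.2), add_zero, add_zero,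
    mainPart_blockTop_sub hθ]

lemma block_blockEnd_sub (d : ℕ) (φ : ℝ → ℝ) (α : ℝ) (k : ℕ) :
    block d φ α k (blockEnd k) - block d φ α k (blockTop k) = blockSlope d α k * (k + 1) := by
  rw [block, block, mainPart_of_blockTop_le (blockTop_le_blockEnd k),
    mainPart_of_blockTop_le le_rfl, tailPart_of_blockEnd_le le_rfl, tailPart_of_le_blockTop le_rfl]
  ring

end Block

/-! ### The profile -/

section Gluing

lemma exists_ge_mem_Icc_of_tendsto {S : ℕ → ℝ} (hS : Tendsto S atTop atTop) {K : ℕ} {t : ℝ}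
    (ht : S K ≤ t) : ∃ k ≥ K, t ∈ Icc (S k) (S (k + 1)) := by
  obtain ⟨n, hn, hKn⟩ := ((hS.eventually_gt_atTop t).and (eventually_ge_atTop K)).exists
  induction n, hKn using Nat.le_induction with
  | base => exact absurd hn ht.not_gt
  | succ n hKn ih => exact (lt_or_ge t (S n)).elim ih fun h => ⟨n, hKn, h, hn.le⟩

lemma antitoneOn_Ici_of_forall_Icc {S : ℕ → ℝ} (hmono : Monotone S) (hS : Tendsto S atTop atTop)
    {g : ℝ → ℝ} {K : ℕ} (hg : ∀ k ≥ K, AntitoneOn g (Icc (S k) (S (k + 1)))) :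
    AntitoneOn g (Ici (S K)) := by
  have hIcc (n : ℕ) : AntitoneOn g (Icc (S K) (S (K + n))) := by
    induction n with
    | zero => simp
    | succ n ih =>
      have hn : S K ≤ S (K + n) := hmono (Nat.le_add_right _ _)
      have hn' : S (K + n) ≤ S (K + n + 1) := hmono (Nat.le_succ _)
      rw [← add_assoc, ← Icc_union_Icc_eq_Icc hn hn']
      exact ih.union_right (hg _ (Nat.le_add_right _ _)) (isGreatest_Icc hn) (isLeast_Icc hn')
  intro s hs t ht hst
  obtain ⟨k, hk, -, htk⟩ := exists_ge_mem_Icc_of_tendsto hS ht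
  obtain ⟨n, hn⟩ := Nat.exists_eq_add_of_le (hk.trans k.le_succ)
  exact hIcc n ⟨hs, hst.trans (hn ▸ htk)⟩ ⟨ht, hn ▸ htk⟩ hst

end Gluing

section Profile

variable {d : ℕ} {φ : ℝ → ℝ} {α : ℝ} {k : ℕ} {s t θ : ℝ}

/-- The covering profile with Assouad dimension `α` and Assouad spectrum `φ`: the blocks grow one
after another, each of them long before the next. -/
def profile (d : ℕ) (φ : ℝ → ℝ) (α : ℝ) (t : ℝ) : ℝ := ∑' k, block d φ α k t

lemma profile_eq_sum {n : ℕ} (h : t ≤ blockStart n) :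
    profile d φ α t = ∑ k ∈ Finset.range n, block d φ α k t :=
  tsum_eq_sum fun _ hk => block_of_le_blockStart
    (h.trans (monotone_blockStart (not_lt.1 (Finset.mem_range.not.1 hk))))

lemma profile_sub_eq_sum {n : ℕ} (hs : s ≤ blockStart n) (ht : t ≤ blockStart n) :
    profile d φ α t - profile d φ α s =
      ∑ k ∈ Finset.range n, (block d φ α k t - block d φ α k s) := by
  rw [profile_eq_sum hs, profile_eq_sum ht, Finset.sum_sub_distrib]

lemma profile_of_le_blockStart_zero (h : t ≤ blockStart 0) : profile d φ α t = 0 := by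
  rw [profile_eq_sum h, Finset.sum_range_zero]

lemma profile_sub_eq_block_sub (hblock : ∀ j < k, blockEnd j ≤ s) (hst : s ≤ t)
    (ht : t ≤ blockStart (k + 1)) :
    profile d φ α t - profile d φ α s = block d φ α k t - block d φ α k s := by
  rw [profile_sub_eq_sum (hst.trans ht) ht, Finset.sum_range_succ, Finset.sum_eq_zero, zero_add]
  intro j hj
  have hjs := hblock j (Finset.mem_range.1 hj)
  rw [block_eq_of_blockEnd_le (hjs.trans hst) hjs, sub_self]

lemma block_sub_le_profile_sub (hφ : φ ∈ classA d) (α : ℝ) (k : ℕ) (hst : s ≤ t) :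
    block d φ α k t - block d φ α k s ≤ profile d φ α t - profile d φ α s := by
  obtain ⟨n, hn, hkn⟩ := ((tendsto_blockStart.eventually_ge_atTop t).and
    (eventually_gt_atTop k)).exists
  rw [profile_sub_eq_sum (hst.trans hn) hn]
  exact Finset.single_le_sum (f := fun j => block d φ α j t - block d φ α j s)
    (fun j _ => sub_nonneg.2 (monotone_block hφ α j hst)) (Finset.mem_range.2 hkn)

lemma monotone_profile (hφ : φ ∈ classA d) (α : ℝ) : Monotone (profile d φ α) := fun _ _ hst =>
  sub_nonneg.1 ((sub_nonneg.2 (monotone_block hφ α 0 hst)).trans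
    (block_sub_le_profile_sub hφ α 0 hst))

lemma profile_nonneg (hφ : φ ∈ classA d) (α t : ℝ) : 0 ≤ profile d φ α t := by
  rw [← profile_of_le_blockStart_zero (d := d) (φ := φ) (α := α) (min_le_right t (blockStart 0))]
  exact monotone_profile hφ α (min_le_left _ _)

lemma mul_succ_le_profile_blockEnd (hφ : φ ∈ classA d) (α : ℝ) (k : ℕ) :
    (d : ℝ) * (k + 1) ≤ profile d φ α (blockEnd k) := by
  have hgrowth (k : ℕ) : profile d φ α (blockStart k) + d ≤ profile d φ α (blockEnd k) := by
    have hstart := monotone_profile hφ α (blockStart_le_blockTop k)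
    have hsub := block_sub_le_profile_sub hφ α k (blockTop_le_blockEnd k)
    have hslope : (d : ℝ) ≤ blockSlope d α k * (k + 1) := by
      rw [← div_le_iff₀ (by positivity)]
      exact le_max_right _ _
    rw [block_blockEnd_sub] at hsub
    linarith
  induction k with
  | zero => simpa using (le_add_of_nonneg_left (profile_nonneg hφ α _)).trans (hgrowth 0)
  | succ k ih =>
    have hgap := monotone_profile hφ α (blockEnd_le_blockStart_succ k)
    have := hgrowth (k + 1)
    push_cast
    linarith

lemma tendsto_profile (hφ : φ ∈ classA d) (hd : 0 < d) (α : ℝ) :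
    Tendsto (profile d φ α) atTop atTop := by
  refine tendsto_atTop_atTop_of_monotone (monotone_profile hφ α) fun b => ?_
  obtain ⟨n, hn⟩ := exists_nat_ge b
  have hone : (1 : ℝ) ≤ d := by exact_mod_cast hd
  refine ⟨blockEnd n, le_trans ?_ (mul_succ_le_profile_blockEnd hφ α n)⟩
  nlinarith [n.cast_nonneg (α := ℝ)]

lemma antitoneOn_profile_sub (hφ : φ ∈ classA d) (hα : ∀ θ ∈ Ioo (0 : ℝ) 1, φ θ ≤ α) {a : ℝ}
    {K : ℕ} (ha : ∀ k ≥ K, blockSlope d α k ≤ a) :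
    AntitoneOn (fun t => profile d φ α t - a * t) (Ici (blockStart K)) := by
  refine antitoneOn_Ici_of_forall_Icc monotone_blockStart tendsto_blockStart
    fun k hk s hs t ht hst => ?_
  have hblock := profile_sub_eq_block_sub (d := d) (φ := φ) (α := α)
    (fun j hj => (blockEnd_le_blockStart hj).trans hs.1) hst ht.2
  have hslope := antitone_block_sub hφ hα k hst
  have := mul_le_mul_of_nonneg_right (ha k hk) (sub_nonneg.2 hst)
  simp only at hslope ⊢
  linarith

lemma antitone_profile_sub (hφ : φ ∈ classA d) (hα : ∀ θ ∈ Ioo (0 : ℝ) 1, φ θ ≤ α) (hαd : α ≤ d) :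
    Antitone fun t => profile d φ α t - d * t := by
  refine AntitoneOn.Iic_union_Ici (a := blockStart 0) (fun s hs t ht hst => ?_)
    (antitoneOn_profile_sub hφ hα fun k _ => blockSlope_le hαd k)
  simp only [profile_of_le_blockStart_zero hs, profile_of_le_blockStart_zero ht]
  gcongr

lemma eventually_blockSlope_le {a : ℝ} (ha : 0 < a) (hα : α ≤ a) :
    ∀ᶠ k in atTop, blockSlope d α k ≤ a := by
  have hlim := (tendsto_const_div_atTop_nhds_zero_nat (d : ℝ)).comp (tendsto_add_atTop_nat 1)
  filter_upwards [hlim.eventually_le_const ha] with k hk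
  exact max_le hα (by exact_mod_cast hk)

lemma mem_slopeExponents_profile (hφ : φ ∈ classA d) (hα : ∀ θ ∈ Ioo (0 : ℝ) 1, φ θ ≤ α) {a : ℝ}
    (ha : α < a) : a ∈ slopeExponents (profile d φ α) := by
  have ha0 : 0 < a := (nonneg_of_forall_le_of_mem_classA hφ hα).trans_lt ha
  obtain ⟨K, hK⟩ := eventually_atTop.1 (eventually_blockSlope_le (d := d) ha0 ha.le)
  have hnonneg := profile_nonneg hφ α
  have hslope {s t : ℝ} (hs : blockStart K ≤ s) (hst : s ≤ t) :
      profile d φ α t - profile d φ α s ≤ a * (t - s) := by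
    have := antitoneOn_profile_sub hφ hα hK hs (hs.trans hst) hst
    simp only at this
    linarith
  refine ⟨profile d φ α (blockStart K), fun s t hst => ?_⟩
  rcases le_total (blockStart K) s with hs | hs
  · exact (hslope hs hst.le).trans (le_add_of_nonneg_right (hnonneg _))
  rcases le_total t (blockStart K) with ht | ht
  · have := mul_nonneg ha0.le (sub_nonneg.2 hst.le)
    linarith [monotone_profile hφ α ht, hnonneg s]
  · have := mul_le_mul_of_nonneg_left (sub_le_sub_left hs t) ha0.le
    linarith [hslope le_rfl ht, hnonneg s]

lemma nonpos_of_eventually_mul_le {u : ℕ → ℝ} (hu : Tendsto u atTop atTop) {x M : ℝ}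
    (h : ∀ᶠ k in atTop, x * u k ≤ M) : x ≤ 0 := by
  by_contra! hx
  obtain ⟨k, hk, hkM⟩ := (h.and ((hu.const_mul_atTop hx).eventually_gt_atTop M)).exists
  exact hkM.not_ge hk

theorem isGLB_slopeExponents_profile (hφ : φ ∈ classA d) (hα : ∀ θ ∈ Ioo (0 : ℝ) 1, φ θ ≤ α) :
    IsGLB (slopeExponents (profile d φ α)) α := by
  refine ⟨fun a ⟨L, hL⟩ => ?_, fun b hb => le_of_forall_gt_imp_ge_of_dense fun a ha =>
    hb (mem_slopeExponents_profile hφ hα ha)⟩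
  refine sub_nonpos.1 (nonpos_of_eventually_mul_le (M := L)
    (tendsto_atTop_add_const_right _ 1 tendsto_natCast_atTop_atTop) (.of_forall fun k => ?_))
  have hk : (0 : ℝ) < k + 1 := by positivity
  have hlength : blockEnd k - blockTop k = k + 1 := add_sub_cancel_left _ _
  have hgrowth := block_sub_le_profile_sub hφ α k (blockTop_le_blockEnd k)
  have hbound := hL (blockTop k) (blockEnd k) (sub_pos.1 (hlength ▸ hk))
  have hslope := mul_le_mul_of_nonneg_right (le_max_left α (d / (k + 1) : ℝ)) hk.le
  rw [block_blockEnd_sub, blockSlope] at hgrowth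
  rw [hlength] at hbound
  linarith

lemma exists_profile_sub_mul_le (hφ : φ ∈ classA d) (hαd : α ≤ d) (hθ : θ ∈ Ioc (0 : ℝ) 1) :
    ∃ B, ∀ t, 0 ≤ t →
      profile d φ α t - profile d φ α (θ * t) ≤ t * increment φ θ + d * √t + B := by
  obtain ⟨K, hK⟩ := exists_nat_ge (1 / θ)
  refine ⟨profile d φ α (blockStart (K + 1)), fun t ht => ?_⟩
  have hθt : θ * t ≤ t := mul_le_of_le_one_left ht hθ.2
  have hnonneg := profile_nonneg hφ α
  have hbound : 0 ≤ t * increment φ θ + d * √t :=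
    add_nonneg (mul_nonneg ht (increment_nonneg hφ hθ.1)) (by positivity)
  rcases le_total t (blockStart (K + 1)) with htK | htK
  · linarith [monotone_profile hφ α htK, hnonneg (θ * t)]
  obtain ⟨k, hk, hkt, htk⟩ := exists_ge_mem_Icc_of_tendsto tendsto_blockStart htK
  obtain ⟨k, rfl⟩ := Nat.exists_eq_add_one_of_ne_zero (K.succ_pos.trans_le hk).ne'
  have hend : blockEnd k ≤ θ * t := by
    have hKk : (K : ℝ) ≤ k + 1 := by exact_mod_cast K.le_succ.trans hk
    have hθk : 1 ≤ θ * (k + 1) := (div_le_iff₀' hθ.1).1 (hK.trans hKk)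
    have := (blockTop_pos k).le.trans (blockTop_le_blockEnd k)
    calc blockEnd k ≤ θ * (k + 1) * blockEnd k := le_mul_of_one_le_left this hθk
      _ = θ * ((k + 1) * blockEnd k) := mul_assoc _ _ _
      _ ≤ θ * t := mul_le_mul_of_nonneg_left ((succ_mul_blockEnd_le k).trans hkt) hθ.1.le
  have hpast (j : ℕ) (hj : j < k + 1) : blockEnd j ≤ θ * t := by
    rcases (Nat.lt_succ_iff.1 hj).eq_or_lt with rfl | hj
    · exact hend
    · exact (blockEnd_le_blockStart hj).trans
        ((blockStart_le_blockTop k).trans ((blockTop_le_blockEnd k).trans hend))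
  rw [profile_sub_eq_block_sub hpast hθt htk]
  exact (block_sub_mul_le hφ hαd (k + 1) hθ ht).trans (le_add_of_nonneg_right (hnonneg _))

lemma mul_sqrt_le_mul_add {η : ℝ} (hη : 0 < η) (x : ℝ) {t : ℝ} (ht : 0 ≤ t) :
    x * √t ≤ η * t + x ^ 2 / η := by
  have hident : η * t + x ^ 2 / η - x * √t = ((η * √t - x / 2) ^ 2 + 3 / 4 * x ^ 2) / η := by
    nth_rw 1 [← Real.mul_self_sqrt ht]
    field_simp
    ring
  have hnonneg : 0 ≤ ((η * √t - x / 2) ^ 2 + 3 / 4 * x ^ 2) / η := by positivity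
  linarith

lemma mem_spectrumExponents_profile (hφ : φ ∈ classA d) (hαd : α ≤ d) (hθ : θ ∈ Ioo (0 : ℝ) 1)
    {a : ℝ} (ha : φ θ < a) : a ∈ spectrumExponents θ (profile d φ α) := by
  obtain ⟨B, hB⟩ := exists_profile_sub_mul_le hφ hαd ⟨hθ.1, hθ.2.le⟩
  have hη : 0 < (1 - θ) * (a - φ θ) := mul_pos (sub_pos.2 hθ.2) (sub_pos.2 ha)
  refine ⟨d ^ 2 / ((1 - θ) * (a - φ θ)) + B, fun t ht => ?_⟩
  have hgrowth := hB t ht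
  rw [increment_of_le_one hθ.2.le] at hgrowth
  linarith [mul_sqrt_le_mul_add hη d ht]

theorem isGLB_spectrumExponents_profile (hφ : φ ∈ classA d) (hαd : α ≤ d)
    (hθ : θ ∈ Ioo (0 : ℝ) 1) : IsGLB (spectrumExponents θ (profile d φ α)) (φ θ) := by
  refine ⟨fun a ⟨L, hL⟩ => ?_, fun b hb => le_of_forall_gt_imp_ge_of_dense fun a ha =>
    hb (mem_spectrumExponents_profile hφ hαd hθ ha)⟩
  have hlim : Tendsto (fun k => (1 - θ) * blockTop k) atTop atTop :=
    (tendsto_atTop_mono blockStart_le_blockTop tendsto_blockStart).const_mul_atTop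
      (sub_pos.2 hθ.2)
  refine sub_nonpos.1 (nonpos_of_eventually_mul_le (M := L) hlim ?_)
  filter_upwards [tendsto_one_div_add_atTop_nhds_zero_nat.eventually_le_const hθ.1] with k hk
  have htop := (blockTop_pos k).le
  have hgrowth := block_sub_le_profile_sub hφ α k (mul_le_of_le_one_left htop hθ.2.le)
  have hbound := hL (blockTop k) htop
  rw [block_blockTop_sub ⟨hk, hθ.2.le⟩, increment_of_le_one hθ.2.le] at hgrowth
  linarith

theorem exists_isHomogeneousMoranSet_assouadDim_eq (hφ : φ ∈ classA d)
    (hα : ∀ θ ∈ Ioo (0 : ℝ) 1, φ θ ≤ α) (hαd : α ≤ d) :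
    ∃ C : Set (E d), IsHomogeneousMoranSet C ∧ assouadDim C = (α : EReal) ∧
      ∀ θ ∈ Ioo (0 : ℝ) 1, assouadSpectrum θ C = (φ θ : EReal) := by
  obtain ⟨r, hr, hprofile⟩ := exists_hasCoveringProfile_moranSet (monotone_profile hφ α)
    (fun t ht => profile_of_le_blockStart_zero (ht.trans (blockStart_pos 0).le))
    (antitone_profile_sub hφ hα hαd) (fun hd => tendsto_profile hφ hd α)
  refine ⟨moranSet d r, ⟨r, hr, rfl⟩, ?_, fun θ hθ => ?_⟩
  · rw [hprofile.assouadDim_eq]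
    exact iInf_coe_eq_of_isGLB (isGLB_slopeExponents_profile hφ hα)
  · rw [hprofile.assouadSpectrum_eq hθ]
    exact iInf_coe_eq_of_isGLB (isGLB_spectrumExponents_profile hφ hαd hθ)

end Profile

end AssouadSpectra

end

theorem theoremt (d : ℕ) (φ : ℝ → ℝ) (hφ : φ ∈ AssouadSpectra.classA d) :
    ∃ φ₁ : ℝ, Tendsto φ (𝓝[<] 1) (𝓝 φ₁) ∧
      ∀ α : ℝ, φ₁ ≤ α → α ≤ d →
        ∃ C : Set (AssouadSpectra.E d), AssouadSpectra.IsHomogeneousMoranSet C ∧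
          AssouadSpectra.assouadDim C = (α : EReal) ∧
          ∀ θ ∈ Ioo (0 : ℝ) 1, AssouadSpectra.assouadSpectrum θ C = (φ θ : EReal) := by
  refine ⟨_, AssouadSpectra.tendsto_sSup_of_mem_classA hφ, fun α hφα hαd => ?_⟩
  have hα (θ : ℝ) (hθ : θ ∈ Ioo (0 : ℝ) 1) : φ θ ≤ α :=
    (AssouadSpectra.le_sSup_image_of_mem_classA hφ hθ).trans hφα
  exact AssouadSpectra.exists_isHomogeneousMoranSet_assouadDim_eq hφ hα hαd
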